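/- A GLP-algebra is a Boolean algebra $\mathcal M$ with unary operations $\langle n\rangle$ ($n<\omega$) such that, writing $[n]x=\neg\langle n\rangle\neg x$, for all $x,y\in\mathcal M$: $\langle n\rangle(x\vee y)=\langle n\rangle x\vee\langle n\rangle y$; $\langle n\rangle 0=0$; $\langle n\rangle x=\langle n\rangle(x\wedge\neg\langle n\rangle x)$; $\langle n\rangle x\le\langle m\rangle x$ for $m\le n$; and $\langle m\rangle x\le[n]\langle m\rangle x$ for $m<n$. Put $Q_n^0(x)=\top$ and $Q_n^{k+1}(x)=\langle n\rangle(x\wedge Q_n^k(x))$. For $A\subseteq\mathcal M$ write $A\vdash x$ if $x$ lies in the filter generated by $A$. The algebra $\mathcal M$ has the $\langle n\rangle$-reduction property if for all $x,z\in\mathcal M$: $\langle n+1\rangle x\vdash\langle n\rangle z$ implies $\{Q_n^k(x):k<\omega\}\vdash\langle n\rangle z$. The logic $\mathbf{GLP}$, in the language with modalities $[n]$, $n<\omega$, and $\langle n\rangle\varphi=\neg[n]\neg\varphi$, has as axioms all propositional tautologies, $[n](\varphi\to\psi)\to([n]\varphi\to[n]\psi)$, $[n]([n]\varphi\to\varphi)\to[n]\varphi$,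 $[m]\varphi\to[n]\varphi$ for $m\le n$, and $\langle m\rangle\varphi\to[n]\langle m\rangle\varphi$ for $m<n$; its rules are modus ponens and $\varphi/[n]\varphi$. The formulas $Q_n^k(\varphi)$ are defined as above. Theorem. (1) For every set of variables, the Lindenbaum algebra of $\mathbf{GLP}$ (formulas modulo provable equivalence) is the free GLP-algebra generated by the classes of the variables. This algebra, and hence every free GLP-algebra on any set of generators, has the $\langle n\rangle$-reduction property for all $n$. (2) If $\mathbf{GLP}\vdash\langle m+1\rangle\psi\to\langle m\rangle\varphi$, then there is a $k$ such that $\mathbf{GLP}\vdash Q_m^k(\psi)\to\langle m\rangle\varphi$. Moreover, $k$ can be chosen depending only on the maximum of the modal depths of $\varphi$ and $\psi$, on the number of variables occurring in $\varphi$ or $\psi$, and on the number of modalities $[i]$ occurring in $\varphi$ or $\psi$. -/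

import Mathlib

universe u v w

namespace GLP

/-! ### GLP-algebras -/

/-- A GLP-algebra: a Boolean algebra with operations `dia n = ⟨n⟩`, `n < ω`. -/
class GLPAlgebra (M : Type u) extends BooleanAlgebra M where
  dia : ℕ → M → M
  dia_sup : ∀ (n : ℕ) (x y : M), dia n (x ⊔ y) = dia n x ⊔ dia n y
  dia_bot : ∀ n : ℕ, dia n ⊥ = ⊥
  dia_loeb : ∀ (n : ℕ) (x : M), dia n x = dia n (x ⊓ (dia n x)ᶜ)
  dia_anti : ∀ (m n : ℕ) (x : M), m ≤ n → dia n x ≤ dia m x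
  dia_le_box_dia : ∀ (m n : ℕ) (x : M), m < n → dia m x ≤ (dia n (dia m x)ᶜ)ᶜ

/-- Homomorphisms of GLP-algebras (a bounded lattice homomorphism between Boolean algebras also
preserves complements). -/
structure GLPHom (M : Type u) (N : Type v) [GLPAlgebra M] [GLPAlgebra N]
    extends BoundedLatticeHom M N where
  map_dia : ∀ (n : ℕ) (x : M), toFun (GLPAlgebra.dia n x) = GLPAlgebra.dia n (toFun x)

/-- `M` is the free GLP-algebra with free generators `g a`, `a : α` (universal property with
respect to the GLP-algebras in the universe `w`). -/
def IsFreeOn {α : Type u} {M : Type v} [GLPAlgebra M] (g : α → M) : Prop :=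
  ∀ (N : Type w) [GLPAlgebra N] (f : α → N),
    ∃! h : GLPHom M N, ∀ a, h.toFun (g a) = f a

/-- `A ⊢ x`: the element `x` lies in the filter generated by `A`. -/
def Entails {M : Type u} [GLPAlgebra M] (A : Set M) (x : M) : Prop :=
  ∃ F : Finset M, (F : Set M) ⊆ A ∧ F.inf id ≤ x

/-- The `⟨n⟩`-conservativity relation `A ⊢ₙ B`. -/
def Conserv {M : Type u} [GLPAlgebra M] (n : ℕ) (A B : Set M) : Prop :=
  ∀ z : M, Entails B (GLPAlgebra.dia n z) → Entails A (GLPAlgebra.dia n z)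

/-- `Q_n^0(x) = ⊤`, `Q_n^{k+1}(x) = ⟨n⟩(x ∧ Q_n^k(x))` in a GLP-algebra. -/
def algQ {M : Type u} [GLPAlgebra M] (n : ℕ) (x : M) : ℕ → M
  | 0 => ⊤
  | k + 1 => GLPAlgebra.dia n (x ⊓ algQ n x k)

/-- The `⟨n⟩`-reduction property. -/
def ReductionProperty (M : Type u) [GLPAlgebra M] (n : ℕ) : Prop :=
  ∀ x : M, Conserv n (Set.range (algQ n x)) {GLPAlgebra.dia (n + 1) x}

/-! ### The logic GLP -/

/-- Polymodal formulas with variables in `α` and modalities `[n]`, `n < ω`. -/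
inductive Formula (α : Type u) : Type u
  | var : α → Formula α
  | bot : Formula α
  | imp : Formula α → Formula α → Formula α
  | box : ℕ → Formula α → Formula α

namespace Formula

variable {α : Type u}

def neg (φ : Formula α) : Formula α := imp φ bot

def top : Formula α := neg bot

def and (φ ψ : Formula α) : Formula α := neg (imp φ (neg ψ))

def or (φ ψ : Formula α) : Formula α := imp (neg φ) ψ

/-- `⟨n⟩φ = ¬[n]¬φ`. -/
def dia (n : ℕ) (φ : Formula α) : Formula α := neg (box n (neg φ))

/-- Modal depth. -/
def depth : Formula α → ℕ
  | var _ => 0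
  | bot => 0
  | imp φ ψ => max φ.depth ψ.depth
  | box _ φ => φ.depth + 1

/-- The (finite) set of variables occurring in a formula. -/
def vars : Formula α → Set α
  | var a => {a}
  | bot => ∅
  | imp φ ψ => φ.vars ∪ ψ.vars
  | box _ φ => φ.vars

/-- The (finite) set of indices `n` of the modalities `[n]` occurring in a formula. -/
def mods : Formula α → Set ℕ
  | var _ => ∅
  | bot => ∅
  | imp φ ψ => φ.mods ∪ ψ.mods
  | box n φ => insert n φ.mods

theorem vars_finite (φ : Formula α) : φ.vars.Finite := by
  induction φ with
  | var a => exact Set.finite_singleton a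
  | bot => exact Set.finite_empty
  | imp φ ψ h1 h2 => exact h1.union h2
  | box n φ h => exact h

theorem mods_finite (φ : Formula α) : φ.mods.Finite := by
  induction φ with
  | var a => exact Set.finite_empty
  | bot => exact Set.finite_empty
  | imp φ ψ h1 h2 => exact h1.union h2
  | box n φ h => exact h.insert n

/-- `Q_n^0(φ) = ⊤`, `Q_n^{k+1}(φ) = ⟨n⟩(φ ∧ Q_n^k(φ))` as formulas. -/
def Q (n : ℕ) (φ : Formula α) : ℕ → Formula α
  | 0 => top
  | k + 1 => dia n (and φ (Q n φ k))

/-- Propositional tautologies: formulas true under every assignment of truth values to formulas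
that commutes with the Boolean connectives. -/
def Tautology (φ : Formula α) : Prop :=
  ∀ t : Formula α → Prop, ¬ t bot → (∀ a b, t (imp a b) ↔ (t a → t b)) → t φ

end Formula

open Formula in
/-- Derivability in the logic GLP. -/
inductive Provable {α : Type u} : Formula α → Prop
  | taut (φ : Formula α) : Tautology φ → Provable φ
  | distr (n : ℕ) (φ ψ : Formula α) :
      Provable (imp (box n (imp φ ψ)) (imp (box n φ) (box n ψ)))
  | loeb (n : ℕ) (φ : Formula α) :
      Provable (imp (box n (imp (box n φ) φ)) (box n φ))
  | mono (m n : ℕ) (φ : Formula α) : m ≤ n → Provable (imp (box m φ) (box n φ))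
  | persist (m n : ℕ) (φ : Formula α) : m < n → Provable (imp (dia m φ) (box n (dia m φ)))
  | mp (φ ψ : Formula α) : Provable (imp φ ψ) → Provable φ → Provable ψ
  | nec (n : ℕ) (φ : Formula α) : Provable φ → Provable (box n φ)

/-! ### The Lindenbaum algebra of GLP -/

section Lindenbaum

variable {α : Type u}

open Formula

theorem Provable.of1 {a c : Formula α} (ha : Provable a) (h : Tautology (imp a c)) :
    Provable c := .mp _ _ (.taut _ h) ha

theorem Provable.of2 {a b c : Formula α} (ha : Provable a) (hb : Provable b)
    (h : Tautology (imp a (imp b c))) : Provable c := .mp _ _ (Provable.of1 ha h) hb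

theorem Provable.box_imp {a b : Formula α} (n : ℕ) (h : Provable (imp a b)) :
    Provable (imp (box n a) (box n b)) := .mp _ _ (.distr n a b) (.nec n _ h)

theorem Provable.dia_imp {a b : Formula α} (n : ℕ) (h : Provable (imp a b)) :
    Provable (imp (dia n a) (dia n b)) := by
  have h1 : Provable (imp (neg b) (neg a)) :=
    Provable.of1 h (fun t hb hi => by simp only [neg, hi]; tauto)
  exact Provable.of1 (Provable.box_imp n h1) (fun t hb hi => by simp only [dia, neg, hi]; tauto)

/-- GLP-provable equivalence of formulas. -/
def provEquiv (α : Type u) : Setoid (Formula α) where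
  r φ ψ := Provable (imp φ ψ) ∧ Provable (imp ψ φ)
  iseqv :=
    { refl := fun φ => ⟨.taut _ (fun t hb hi => by simp only [hi]; tauto),
        .taut _ (fun t hb hi => by simp only [hi]; tauto)⟩
      symm := fun h => ⟨h.2, h.1⟩
      trans := fun h k =>
        ⟨Provable.of2 h.1 k.1 (fun t hb hi => by simp only [hi]; tauto),
          Provable.of2 h.2 k.2 (fun t hb hi => by simp only [hi]; tauto)⟩ }

/-- The Lindenbaum algebra of GLP with variables in `α`: formulas modulo provable equivalence. -/
def Lindenbaum (α : Type u) : Type u := Quotient (provEquiv α)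

/-- The class of a formula. -/
def cls (φ : Formula α) : Lindenbaum α := Quotient.mk (provEquiv α) φ

/-- The generators: classes of the variables. -/
def gen (a : α) : Lindenbaum α := cls (var a)

theorem cls_eq {φ ψ : Formula α} (h : Provable (imp φ ψ)) (k : Provable (imp ψ φ)) :
    cls φ = cls ψ := Quotient.sound (s := provEquiv α) ⟨h, k⟩

namespace Lindenbaum

instance : LE (Lindenbaum α) where
  le := Quotient.lift₂ (s₁ := provEquiv α) (s₂ := provEquiv α) (fun φ ψ => Provable (imp φ ψ))
    (fun a b c d h k => propext
      ⟨fun q => Provable.of2 (Provable.of2 h.2 q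
          (c := imp c b) (fun t hb hi => by simp only [hi]; tauto)) k.1
          (fun t hb hi => by simp only [hi]; tauto),
        fun q => Provable.of2 (Provable.of2 h.1 q
          (c := imp a d) (fun t hb hi => by simp only [hi]; tauto)) k.2
          (fun t hb hi => by simp only [hi]; tauto)⟩)

theorem cls_le {φ ψ : Formula α} : cls φ ≤ cls ψ ↔ Provable (imp φ ψ) := Iff.rfl

/-- Conjunction of classes. -/
def inf : Lindenbaum α → Lindenbaum α → Lindenbaum α :=
  Quotient.map₂ (sa := provEquiv α) (sb := provEquiv α) (sc := provEquiv α) Formula.and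
    (fun _ _ h _ _ k =>
      ⟨Provable.of2 h.1 k.1 (fun t hb hi => by simp only [Formula.and, neg, hi]; tauto),
        Provable.of2 h.2 k.2 (fun t hb hi => by simp only [Formula.and, neg, hi]; tauto)⟩)

/-- Disjunction of classes. -/
def sup : Lindenbaum α → Lindenbaum α → Lindenbaum α :=
  Quotient.map₂ (sa := provEquiv α) (sb := provEquiv α) (sc := provEquiv α) Formula.or
    (fun _ _ h _ _ k =>
      ⟨Provable.of2 h.1 k.1 (fun t hb hi => by simp only [Formula.or, neg, hi]; tauto),
        Provable.of2 h.2 k.2 (fun t hb hi => by simp only [Formula.or, neg, hi]; tauto)⟩)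

/-- Negation of classes. -/
def compl : Lindenbaum α → Lindenbaum α :=
  Quotient.map (sa := provEquiv α) (sb := provEquiv α) Formula.neg
    (fun _ _ h =>
      ⟨Provable.of1 h.2 (fun t hb hi => by simp only [neg, hi]; tauto),
        Provable.of1 h.1 (fun t hb hi => by simp only [neg, hi]; tauto)⟩)

/-- The operation `⟨n⟩` on classes. -/
def diam (n : ℕ) : Lindenbaum α → Lindenbaum α :=
  Quotient.map (sa := provEquiv α) (sb := provEquiv α) (Formula.dia n)
    (fun _ _ h => ⟨Provable.dia_imp n h.1, Provable.dia_imp n h.2⟩)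

theorem ind {p : Lindenbaum α → Prop} (h : ∀ φ, p (cls φ)) (x : Lindenbaum α) : p x :=
  Quotient.ind (s := provEquiv α) h x

instance : BooleanAlgebra (Lindenbaum α) where
  le := (· ≤ ·)
  le_refl := ind fun a => cls_le.2 (.taut _ fun t hb hi => by simp only [hi]; tauto)
  le_trans := ind fun a => ind fun b => ind fun c => fun h k =>
    cls_le.2 (Provable.of2 (cls_le.1 h) (cls_le.1 k) fun t hb hi => by simp only [hi]; tauto)
  le_antisymm := ind fun a => ind fun b => fun h k => cls_eq (cls_le.1 h) (cls_le.1 k)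
  sup := sup
  le_sup_left := ind fun a => ind fun b =>
    cls_le.2 (.taut _ fun t hb hi => by simp only [Formula.or, neg, hi]; tauto)
  le_sup_right := ind fun a => ind fun b =>
    cls_le.2 (.taut _ fun t hb hi => by simp only [Formula.or, neg, hi]; tauto)
  sup_le := ind fun a => ind fun b => ind fun c => fun h k =>
    cls_le.2 (Provable.of2 (cls_le.1 h) (cls_le.1 k)
      fun t hb hi => by simp only [Formula.or, neg, hi]; tauto)
  inf := inf
  inf_le_left := ind fun a => ind fun b =>
    cls_le.2 (.taut _ fun t hb hi => by simp only [Formula.and, neg, hi]; tauto)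
  inf_le_right := ind fun a => ind fun b =>
    cls_le.2 (.taut _ fun t hb hi => by simp only [Formula.and, neg, hi]; tauto)
  le_inf := ind fun a => ind fun b => ind fun c => fun h k =>
    cls_le.2 (Provable.of2 (cls_le.1 h) (cls_le.1 k)
      fun t hb hi => by simp only [Formula.and, neg, hi]; tauto)
  le_sup_inf := ind fun a => ind fun b => ind fun c =>
    cls_le.2 (.taut _ fun t hb hi => by simp only [Formula.and, Formula.or, neg, hi]; tauto)
  top := cls Formula.top
  bot := cls Formula.bot
  le_top := ind fun a => cls_le.2 (.taut _ fun t hb hi => by simp only [Formula.top, neg, hi]; tauto)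
  bot_le := ind fun a => cls_le.2 (.taut _ fun t hb hi => by simp only [hi]; tauto)
  compl := compl
  inf_compl_le_bot := ind fun a =>
    cls_le.2 (.taut _ fun t hb hi => by simp only [Formula.and, neg, hi]; tauto)
  top_le_sup_compl := ind fun a =>
    cls_le.2 (.taut _ fun t hb hi => by simp only [Formula.or, Formula.top, neg, hi]; tauto)

instance : GLPAlgebra (Lindenbaum α) where
  dia := diam
  dia_sup n := ind fun a => ind fun b => by
    refine cls_eq ?_ ?_
    · have h1 : Provable (imp (neg a) (imp (neg b) (neg (Formula.or a b)))) :=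
        .taut _ fun t hb hi => by simp only [Formula.or, neg, hi]; tauto
      have h2 := Provable.of2 (Provable.box_imp n h1) (Provable.distr n (neg b) (neg (a.or b)))
        (c := imp (box n (neg a)) (imp (box n (neg b)) (box n (neg (a.or b)))))
        fun t hb hi => by simp only [hi]; tauto
      exact Provable.of1 h2 fun t hb hi => by simp only [dia, Formula.or, neg, hi]; tauto
    · have h1 : Provable (imp a (a.or b)) :=
        .taut _ fun t hb hi => by simp only [Formula.or, neg, hi]; tauto
      have h2 : Provable (imp b (a.or b)) :=
        .taut _ fun t hb hi => by simp only [Formula.or, neg, hi]; tauto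
      exact Provable.of2 (Provable.dia_imp n h1) (Provable.dia_imp n h2)
        fun t hb hi => by
          have e : ∀ x y : Formula α, t (x.or y) ↔ (t x ∨ t y) := fun x y => by
            simp only [Formula.or, neg, hi]; tauto
          simp only [hi, e]; tauto
  dia_bot n := by
    refine cls_eq ?_ ?_
    · have h : Provable (neg (bot : Formula α)) :=
        .taut _ fun t hb hi => by simp only [neg, hi]; tauto
      exact Provable.of1 (.nec n _ h) fun t hb hi => by simp only [dia, neg, hi]; tauto
    · exact .taut _ fun t hb hi => by simp only [hi]; tauto
  dia_loeb n := ind fun a => by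
    refine cls_eq ?_ ?_
    · have h1 : Provable (imp (neg (a.and (neg (dia n a)))) (imp (box n (neg a)) (neg a))) :=
        .taut _ fun t hb hi => by simp only [Formula.and, dia, neg, hi]; tauto
      exact Provable.of2 (Provable.box_imp n h1) (Provable.loeb n (neg a))
        fun t hb hi => by
          have e : ∀ x : Formula α, t (dia n x) ↔ ¬ t (box n (neg x)) := fun x => by
            simp only [dia, neg, hi]; tauto
          simp only [hi, e]; tauto
    · exact Provable.dia_imp n
        (.taut _ fun t hb hi => by simp only [Formula.and, neg, hi]; tauto)
  dia_anti m n := ind fun a => fun h => cls_le.2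
    (Provable.of1 (.mono m n (neg a) h) fun t hb hi => by simp only [dia, neg, hi]; tauto)
  dia_le_box_dia m n := ind fun a => fun h => cls_le.2 (by
    have h1 : Provable (imp (dia m a) (neg (neg (dia m a)))) :=
      .taut _ fun t hb hi => by simp only [dia, neg, hi]; tauto
    exact Provable.of2 (Provable.persist m n a h) (Provable.box_imp n h1)
      fun t hb hi => by
        have e : ∀ x : Formula α, t (neg (dia n x)) ↔ t (box n (neg x)) := fun x => by
          simp only [dia, neg, hi]; tauto
        change t (imp _ (imp _ (imp _ (neg (dia n (neg (dia m a)))))))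
        simp only [hi, e]; tauto)

end Lindenbaum

end Lindenbaum

end GLP

/-! Freeness is the usual argument: evaluation in a GLP-algebra respects provability, so it descends
to classes, and a homomorphism is determined on formulas by its values on the variables.

For reduction, suppose `⟨n+1⟩x ≤ ⟨n⟩z` in a free algebra while no `Q_n^k(x)` lies below `⟨n⟩z`.
Points satisfying some `a ∧ ¬⟨n⟩a`, for `a` in a finite set `F`, form `⟨n⟩`-chains of length at most
`|F|`. Hence `x ∧ ¬⟨n⟩z` lies outside the ideal generated by these elements
(`exists_algQ_le_of_inf_le_sup`), and some ultrafilter `U` contains `x ∧ ¬⟨n⟩z` and sees itself via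
`⟨n⟩`. Add a new point that agrees with `U` on `⟨j⟩` for `j ≤ n`, sees `U` and the
`⟨n+1⟩`-successors of `U` via `⟨n+1⟩`, and sees nothing via higher modalities. The result is again a
GLP-algebra. By freeness the inequality holds at the new point (`IsFreeOn.of_dia_le`); there
`⟨n+1⟩x` holds, hence `⟨n⟩z`, which then lies in `U`, a contradiction.

The uniform bound follows by compactness. Provability is stable under substitution and strictly
increasing relabelling of modalities. Up to equivalence there are finitely many formulas of given
complexity with normalized labels, and the labellings are well-quasi-ordered by their values and
gaps. Among counterexamples to ever larger bounds, one is therefore a relabelling of an earlier one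
and inherits its finite bound. -/

namespace GLP

/-! ### Freeness of the Lindenbaum algebra -/

section Free

open Formula

theorem GLPHom.ext {M : Type u} {N : Type v} [GLPAlgebra M] [GLPAlgebra N] {h k : GLPHom M N}
    (e : ∀ x, h.toFun x = k.toFun x) : h = k := by
  obtain ⟨h, _⟩ := h
  obtain ⟨k, _⟩ := k
  have : h = k := DFunLike.ext _ _ e
  subst this
  rfl

theorem GLPHom.map_compl {M : Type u} {N : Type v} [GLPAlgebra M] [GLPAlgebra N] (h : GLPHom M N)
    (x : M) : h.toFun xᶜ = (h.toFun x)ᶜ :=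
  _root_.map_compl' h.toBoundedLatticeHom x

/-- The identity homomorphism. -/
def GLPHom.id (M : Type u) [GLPAlgebra M] : GLPHom M M where
  toBoundedLatticeHom := BoundedLatticeHom.id M
  map_dia _ _ := rfl

/-- Composition of homomorphisms. -/
def GLPHom.comp {M N P : Type u} [GLPAlgebra M] [GLPAlgebra N] [GLPAlgebra P]
    (h : GLPHom N P) (k : GLPHom M N) : GLPHom M P where
  toBoundedLatticeHom := h.toBoundedLatticeHom.comp k.toBoundedLatticeHom
  map_dia n x := (congrArg h.toFun (k.map_dia n x)).trans (h.map_dia n _)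

variable {α : Type u} {N : Type w} [GLPAlgebra N]

/-- The value of a formula in a GLP-algebra. -/
def eval (f : α → N) : Formula α → N
  | var a => f a
  | bot => ⊥
  | imp φ ψ => (eval f φ)ᶜ ⊔ eval f ψ
  | box n φ => (GLPAlgebra.dia n (eval f φ)ᶜ)ᶜ

theorem dia_mono {n : ℕ} {x y : N} (h : x ≤ y) : GLPAlgebra.dia n x ≤ GLPAlgebra.dia n y := by
  rw [← sup_eq_right.2 h, GLPAlgebra.dia_sup]
  exact le_sup_left

theorem eval_and (f : α → N) (φ ψ : Formula α) :
    eval f (φ.and ψ) = eval f φ ⊓ eval f ψ := by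
  simp [Formula.and, neg, eval]

theorem eval_or (f : α → N) (φ ψ : Formula α) :
    eval f (φ.or ψ) = eval f φ ⊔ eval f ψ := by
  simp [Formula.or, neg, eval]

theorem eval_dia (f : α → N) (n : ℕ) (φ : Formula α) :
    eval f (dia n φ) = GLPAlgebra.dia n (eval f φ) := by
  simp [dia, neg, eval]

theorem eval_imp_eq_top (f : α → N) (φ ψ : Formula α) :
    eval f (imp φ ψ) = ⊤ ↔ eval f φ ≤ eval f ψ := by
  rw [eval, sup_comm, ← himp_eq, himp_eq_top_iff]

/-- A prime ideal of a Boolean algebra turns an evaluation into a truth assignment. -/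
theorem eval_tautology (f : α → N) {φ : Formula α} (h : Tautology φ) : eval f φ = ⊤ := by
  by_contra hne
  have hd : Disjoint ((Order.PFilter.principal (eval f φ)ᶜ : Order.PFilter N) : Set N)
      ((Order.Ideal.principal ⊥ : Order.Ideal N) : Set N) := by
    rw [Set.disjoint_left]
    intro x hx hx'
    have h1 : (eval f φ)ᶜ ≤ x := hx
    have h2 : x ≤ ⊥ := hx'
    exact hne (compl_eq_bot.1 (le_bot_iff.1 (h1.trans h2)))
  obtain ⟨J, hJ, -, hdJ⟩ := DistribLattice.prime_ideal_of_disjoint_filter_ideal hd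
  have hφ : (eval f φ)ᶜ ∉ J := fun hm => Set.disjoint_left.1 hdJ (le_refl (eval f φ)ᶜ) hm
  have := h (fun χ => eval f χ ∉ J) (by simp [eval]) (by
    intro a b
    simp only [eval, Order.Ideal.sup_mem_iff, not_and_or]
    have h1 : (eval f a)ᶜ ∉ J ↔ eval f a ∈ J :=
      ⟨fun h => hJ.mem_or_compl_mem.resolve_right h, fun h h' => by
        have := Order.Ideal.sup_mem h h'
        rw [sup_compl_eq_top] at this
        exact hJ.toIsProper.top_notMem this⟩
    rw [h1]; tauto)
  exact this (hJ.mem_or_compl_mem.resolve_right hφ)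

/-- Transitivity comes from Löb's axiom applied to `x ∨ ⟨n⟩x`: a last point satisfying this
disjunction cannot satisfy `⟨n⟩x`, so it satisfies `x`. -/
theorem dia_dia_le (n : ℕ) (x : N) :
    GLPAlgebra.dia n (GLPAlgebra.dia n x) ≤ GLPAlgebra.dia n x := by
  have h1 : GLPAlgebra.dia n (GLPAlgebra.dia n x) ≤
      GLPAlgebra.dia n (x ⊔ GLPAlgebra.dia n x) := dia_mono le_sup_right
  refine h1.trans ?_
  conv_lhs => rw [GLPAlgebra.dia_loeb]
  refine dia_mono ?_
  rw [GLPAlgebra.dia_sup, compl_sup, inf_sup_right]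
  refine sup_le inf_le_left ?_
  rw [← inf_assoc, inf_compl_self, bot_inf_eq]
  exact bot_le

theorem eval_provable (f : α → N) {φ : Formula α} (h : Provable φ) : eval f φ = ⊤ := by
  induction h with
  | taut φ h => exact eval_tautology f h
  | distr n φ ψ =>
    rw [eval_imp_eq_top]
    simp only [eval]
    rw [sup_comm (GLPAlgebra.dia n (eval f φ)ᶜ)ᶜᶜ, ← himp_eq, le_himp_iff, ← compl_sup,
      compl_le_compl_iff_le, ← GLPAlgebra.dia_sup]
    refine dia_mono ?_
    rw [← compl_inf, compl_le_compl_iff_le, inf_comm, inf_sup_left, inf_compl_self, bot_sup_eq]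
    exact inf_le_right
  | loeb n φ =>
    rw [eval_imp_eq_top]
    simp only [eval]
    rw [compl_le_compl_iff_le]
    conv_lhs => rw [GLPAlgebra.dia_loeb]
    refine dia_mono ?_
    simp [inf_comm]
  | mono m n φ h =>
    rw [eval_imp_eq_top]
    exact compl_le_compl (GLPAlgebra.dia_anti m n _ h)
  | persist m n φ h =>
    rw [eval_imp_eq_top, eval, eval_dia]
    exact GLPAlgebra.dia_le_box_dia m n _ h
  | mp φ ψ _ _ h1 h2 =>
    rw [eval_imp_eq_top, h2, top_le_iff] at h1
    exact h1
  | nec n φ _ h => simp [eval, h, GLPAlgebra.dia_bot]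

/-- The homomorphism from the Lindenbaum algebra given by evaluation. -/
def lift (f : α → N) : GLPHom (Lindenbaum α) N where
  toFun := Quotient.lift (s := provEquiv α) (eval f) fun a b h =>
    le_antisymm ((eval_imp_eq_top f a b).1 (eval_provable f h.1))
      ((eval_imp_eq_top f b a).1 (eval_provable f h.2))
  map_sup' := Lindenbaum.ind fun a => Lindenbaum.ind fun b => eval_or f a b
  map_inf' := Lindenbaum.ind fun a => Lindenbaum.ind fun b => eval_and f a b
  map_top' := by
    change eval f top = ⊤
    simp [top, neg, eval]
  map_bot' := rfl
  map_dia n := Lindenbaum.ind fun a => eval_dia f n a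

theorem cls_imp (a b : Formula α) : cls (imp a b) = (cls a)ᶜ ⊔ cls b :=
  cls_eq (.taut _ fun t hb hi => by simp only [Formula.or, neg, hi]; tauto)
    (.taut _ fun t hb hi => by simp only [Formula.or, neg, hi]; tauto)

theorem cls_dia (n : ℕ) (a : Formula α) : cls (dia n a) = GLPAlgebra.dia n (cls a) := rfl

theorem cls_box (n : ℕ) (a : Formula α) : cls (box n a) = (GLPAlgebra.dia n (cls a)ᶜ)ᶜ := by
  have h1 : Provable (imp a (neg (neg a))) := .taut _ fun t hb hi => by simp only [neg, hi]; tauto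
  have h2 : Provable (imp (neg (neg a)) a) := .taut _ fun t hb hi => by simp only [neg, hi]; tauto
  exact cls_eq
    (Provable.of1 (Provable.box_imp n h1) fun t hb hi => by simp only [dia, neg, hi]; tauto)
    (Provable.of1 (Provable.box_imp n h2) fun t hb hi => by simp only [dia, neg, hi]; tauto)

theorem isFreeOn_gen (α : Type u) : IsFreeOn.{u, u, w} (gen (α := α)) := by
  intro N _ f
  refine ⟨lift f, fun a => rfl, fun h hh => GLPHom.ext (Lindenbaum.ind fun φ => ?_)⟩
  change h.toFun (cls φ) = eval f φ
  induction φ with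
  | var a => exact hh a
  | bot => exact h.map_bot'
  | imp a b iha ihb =>
    rw [cls_imp, eval, ← iha, ← ihb, ← GLPHom.map_compl]
    exact h.map_sup' _ _
  | box n a iha => rw [cls_box, eval, ← iha, GLPHom.map_compl, h.map_dia, GLPHom.map_compl]

end Free

/-! ### Points added to a GLP-algebra -/

section Extension

open GLPAlgebra

open Classical in
/-- The GLP-algebra obtained by adding to the dual space of `M` one new point, which nobody sees
and at which `⟨n⟩x` holds iff `D n x`. -/
@[reducible]
noncomputable def pointExtension {M : Type u} [GLPAlgebra M] (D : ℕ → M → Prop)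
    (D_sup : ∀ n x y, D n (x ⊔ y) ↔ D n x ∨ D n y) (D_bot : ∀ n, ¬ D n ⊥)
    (D_loeb : ∀ n x, D n x → D n (x ⊓ (dia n x)ᶜ))
    (D_anti : ∀ m n x, m ≤ n → D n x → D m x)
    (D_persist : ∀ m n x, m < n → D m x → ¬ D n (dia m x)ᶜ) : GLPAlgebra (M × Bool) :=
  { (inferInstance : BooleanAlgebra (M × Bool)) with
    dia := fun n x => (dia n x.1, decide (D n x.1))
    dia_sup := fun n x y => Prod.ext (dia_sup n _ _) (by
      change decide (D n (x.1 ⊔ y.1)) = (decide (D n x.1) || decide (D n y.1))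
      simp [D_sup])
    dia_bot := fun n => Prod.ext (dia_bot n) (by
      change decide (D n ⊥) = false
      simp [D_bot])
    dia_loeb := fun n x => Prod.ext (dia_loeb n _) (by
      change decide (D n x.1) = decide (D n (x.1 ⊓ (dia n x.1)ᶜ))
      refine decide_eq_decide.2 ⟨D_loeb n _, fun h => ?_⟩
      have h1 := (D_sup n x.1 (x.1 ⊓ (dia n x.1)ᶜ)).2 (Or.inr h)
      rwa [sup_inf_self] at h1)
    dia_anti := fun m n x h => ⟨dia_anti m n _ h, by
      change decide (D n x.1) ≤ decide (D m x.1)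
      by_cases hx : D n x.1
      · simp [D_anti m n _ h hx]
      · simp [hx]⟩
    dia_le_box_dia := fun m n x h => ⟨dia_le_box_dia m n _ h, by
      change decide (D m x.1) ≤ !(decide (D n (dia m x.1)ᶜ))
      by_cases hx : D m x.1
      · simp [D_persist m n _ h hx]
      · simp [hx]⟩ }

open Classical in
/-- In a free algebra, a new point as in `pointExtension` cannot satisfy `⟨n⟩x` without
satisfying `⟨m⟩z` when `⟨n⟩x ≤ ⟨m⟩z`. -/
theorem IsFreeOn.of_dia_le {α M : Type u} [GLPAlgebra M] {g : α → M} (hg : IsFreeOn.{u, u, u} g)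
    (D : ℕ → M → Prop)
    (D_sup : ∀ n x y, D n (x ⊔ y) ↔ D n x ∨ D n y) (D_bot : ∀ n, ¬ D n ⊥)
    (D_loeb : ∀ n x, D n x → D n (x ⊓ (dia n x)ᶜ))
    (D_anti : ∀ m n x, m ≤ n → D n x → D m x)
    (D_persist : ∀ m n x, m < n → D m x → ¬ D n (dia m x)ᶜ)
    {m n : ℕ} {x z : M} (hle : dia n x ≤ dia m z) (hx : D n x) : D m z := by
  let E : GLPAlgebra (M × Bool) := pointExtension D D_sup D_bot D_loeb D_anti D_persist
  -- The truth values of the generators at the new point are arbitrary, since nothing sees that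
  -- point.
  obtain ⟨h, hh, -⟩ := @hg (M × Bool) E fun a => (g a, false)
  let p : GLPHom (M × Bool) M :=
    { toFun := Prod.fst
      map_sup' := fun _ _ => rfl
      map_inf' := fun _ _ => rfl
      map_top' := rfl
      map_bot' := rfl
      map_dia := fun _ _ => rfl }
  obtain ⟨k, -, hk⟩ := hg M g
  -- The first coordinate of `h` is an endomorphism fixing the generators, so it is the identity by
  -- uniqueness.
  have hp : ∀ y, (h.toFun y).1 = y := by
    have e : p.comp h = GLPHom.id M :=
      (hk (p.comp h) fun a => congrArg Prod.fst (hh a)).trans (hk (GLPHom.id M) fun a => rfl).symm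
    intro y
    exact congrArg (fun q : GLPHom M M => q.toFun y) e
  have hmono : h.toFun (dia n x) ≤ h.toFun (dia m z) :=
    OrderHomClass.mono h.toBoundedLatticeHom hle
  rw [h.map_dia, h.map_dia] at hmono
  have h2 : decide (D n (h.toFun x).1) ≤ decide (D m (h.toFun z).1) := hmono.2
  rw [hp, hp, decide_eq_true hx] at h2
  exact of_decide_eq_true (top_le_iff.1 h2)

end Extension

/-! ### The reduction property of free algebras -/

section Reduction

open GLPAlgebra

variable {M : Type u} [GLPAlgebra M]

theorem algQ_mono (n : ℕ) {x y : M} (h : x ≤ y) (k : ℕ) : algQ n x k ≤ algQ n y k := by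
  induction k with
  | zero => exact le_rfl
  | succ k ih => exact dia_mono (inf_le_inf h ih)

theorem algQ_succ_le (n : ℕ) (x : M) (k : ℕ) : algQ n x (k + 1) ≤ algQ n x k := by
  induction k with
  | zero => exact le_top
  | succ k ih => exact dia_mono (inf_le_inf le_rfl ih)

theorem algQ_antitone (n : ℕ) (x : M) : Antitone (algQ n x) :=
  antitone_nat_of_succ_le (algQ_succ_le n x)

/-- If no successor satisfies `y`, then by transitivity every successor satisfies both `¬y` and
`¬⟨n⟩y`. -/
theorem compl_dia_inf_dia_le (n : ℕ) (x y : M) :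
    (dia n y)ᶜ ⊓ dia n x ≤ dia n (x ⊓ ((dia n y)ᶜ ⊓ yᶜ)) := by
  have h1 : dia n (dia n y ⊔ y) = dia n y := by
    rw [dia_sup]
    exact sup_eq_right.2 (dia_dia_le n y)
  have h2 : dia n x ≤ dia n (x ⊓ (dia n y ⊔ y)ᶜ) ⊔ dia n y := by
    rw [← h1, ← dia_sup, h1]
    refine dia_mono ?_
    rw [sup_inf_right, sup_comm (dia n y ⊔ y)ᶜ, sup_compl_eq_top, inf_top_eq]
    exact le_sup_left
  rw [← compl_sup, inf_comm, ← sdiff_eq, sdiff_le_iff, sup_comm]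
  exact h2

theorem compl_dia_inf_algQ_le (n : ℕ) (x y : M) (k : ℕ) :
    (dia n y)ᶜ ⊓ algQ n x k ≤ algQ n (x ⊓ ((dia n y)ᶜ ⊓ yᶜ)) k := by
  induction k with
  | zero => exact le_top
  | succ k ih =>
    refine (compl_dia_inf_dia_le n _ _).trans (dia_mono (le_inf ?_ ?_))
    · exact inf_le_inf inf_le_left le_rfl
    · exact (le_inf (inf_le_right.trans inf_le_left) (inf_le_left.trans inf_le_right)).trans ih

/-- A chain of points, each satisfying one of the elements `x ∧ ¬⟨n⟩x`, `x ∈ F`, has length at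
most the cardinality of `F`. -/
theorem sup_inf_algQ_card_eq_bot (n : ℕ) (F : Finset M) :
    F.sup (fun x => x ⊓ (dia n x)ᶜ) ⊓ algQ n (F.sup fun x => x ⊓ (dia n x)ᶜ) F.card = ⊥ := by
  classical
  induction F using Finset.strongInduction with
  | H F ih =>
    rw [Finset.sup_inf_distrib_right, Finset.sup_eq_bot_iff]
    intro x hx
    have hc : F.card = (F.erase x).card + 1 := (Finset.card_erase_add_one hx).symm
    have h0 : algQ n ((F.erase x).sup fun x => x ⊓ (dia n x)ᶜ) F.card = ⊥ := by
      rw [hc, algQ, ih _ (Finset.erase_ssubset hx), dia_bot]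
    rw [← le_bot_iff, ← h0]
    -- A point satisfying `x ∧ ¬⟨n⟩x` sees no other such point, so the rest of the chain uses only
    -- `F.erase x`.
    have h1 : x ⊓ (dia n x)ᶜ ≤ (dia n (x ⊓ (dia n x)ᶜ))ᶜ := by
      rw [← dia_loeb]
      exact inf_le_right
    refine (inf_le_inf h1 le_rfl).trans ((compl_dia_inf_algQ_le n _ _ _).trans (algQ_mono n ?_ _))
    refine (inf_le_inf le_rfl inf_le_right).trans ?_
    rw [← sdiff_eq, sdiff_le_iff, ← Finset.sup_insert (f := fun x => x ⊓ (dia n x)ᶜ),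
      Finset.insert_erase hx]

/-- Below `¬⟨n⟩z`, a chain witnessing `Q_n^k(x)` stays inside `x ∧ ¬⟨n⟩z`, so it has at most `|F|`
points and `k = |F| + 1` is impossible. -/
theorem exists_algQ_le_of_inf_le_sup (n : ℕ) (x z : M) (F : Finset M)
    (h : x ⊓ (dia n z)ᶜ ≤ F.sup fun x => x ⊓ (dia n x)ᶜ) : ∃ k, algQ n x k ≤ dia n z := by
  refine ⟨F.card + 1, ?_⟩
  have h1 : (dia n z)ᶜ ⊓ algQ n x (F.card + 1) ≤ ⊥ := by
    refine (compl_dia_inf_algQ_le n x z _).trans ?_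
    refine (algQ_mono n ((inf_le_inf le_rfl inf_le_left).trans h) _).trans ?_
    rw [algQ, sup_inf_algQ_card_eq_bot, dia_bot]
  rw [inf_comm, ← sdiff_eq, sdiff_le_iff, sup_bot_eq] at h1
  exact h1

/-- The ideal of elements below finite joins of elements `x ∧ ¬⟨n⟩x`. -/
def nonReflexiveIdeal (M : Type u) [GLPAlgebra M] (n : ℕ) : Order.Ideal M where
  carrier := {a | ∃ F : Finset M, a ≤ F.sup fun x => x ⊓ (dia n x)ᶜ}
  lower' := fun _ _ hba ⟨F, hF⟩ => ⟨F, hba.trans hF⟩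
  nonempty' := ⟨⊥, ∅, bot_le⟩
  directed' := by
    classical
    rintro a ⟨F, hF⟩ b ⟨G, hG⟩
    refine ⟨a ⊔ b, ⟨F ∪ G, ?_⟩, le_sup_left, le_sup_right⟩
    rw [Finset.sup_union]
    exact sup_le_sup hF hG

theorem IsFreeOn.exists_algQ_le {α M : Type u} [GLPAlgebra M] {g : α → M}
    (hg : IsFreeOn.{u, u, u} g) (n : ℕ) (x z : M) (hle : dia (n + 1) x ≤ dia n z) :
    ∃ k, algQ n x k ≤ dia n z := by
  by_contra hne
  have hd : Disjoint ((Order.PFilter.principal (x ⊓ (dia n z)ᶜ) : Order.PFilter M) : Set M)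
      (nonReflexiveIdeal M n : Set M) := by
    rw [Set.disjoint_left]
    rintro a ha ⟨F, hF⟩
    exact hne (exists_algQ_le_of_inf_le_sup n x z F (le_trans ha hF))
  obtain ⟨J, hJ, hIJ, hdJ⟩ := DistribLattice.prime_ideal_of_disjoint_filter_ideal hd
  have h0 : x ⊓ (dia n z)ᶜ ∉ J := fun hm => Set.disjoint_left.1 hdJ (le_refl (x ⊓ (dia n z)ᶜ)) hm
  have hx : x ∉ J := fun h => h0 (J.lower inf_le_left h)
  have hcompl : ∀ {a : M}, a ∉ J → aᶜ ∈ J := fun h => hJ.mem_or_compl_mem.resolve_left h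
  have hz : dia n z ∈ J := by
    by_contra h
    exact h0 (J.lower inf_le_right (hcompl h))
  have hinf : ∀ {a b : M}, a ∉ J → b ∉ J → a ⊓ b ∉ J := fun ha hb hab =>
    (hJ.mem_or_mem hab).elim ha hb
  have hnc : ∀ {a : M}, a ∈ J → aᶜ ∉ J := fun h h' => by
    have := Order.Ideal.sup_mem h h'
    rw [sup_compl_eq_top] at this
    exact hJ.toIsProper.top_notMem this
  -- The complement of `J` is the ultrafilter `U`; since `J` contains every `a ∧ ¬⟨n⟩a`, it sees
  -- itself via `⟨n⟩`.
  have hrefl : ∀ {a : M}, a ∉ J → dia n a ∉ J := fun {a} ha hda =>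
    hinf ha (hnc hda) (hIJ ⟨{a}, by simp⟩)
  have hbox : ∀ {i j : ℕ} {a : M}, i < j → dia i a ∉ J → dia j (dia i a)ᶜ ∈ J := by
    intro i j a hij ha
    by_contra h
    exact ha (J.lower (dia_le_box_dia i j a hij) (hcompl h))
  -- The new point copies `U` for `j ≤ n`, sees `U` and its successors for `j = n + 1`, and sees
  -- nothing for larger `j`.
  let D : ℕ → M → Prop := fun j a =>
    (j ≤ n ∧ dia j a ∉ J) ∨ (j = n + 1 ∧ (a ∉ J ∨ dia (n + 1) a ∉ J))
  have key : D n z := by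
    refine hg.of_dia_le D ?_ ?_ ?_ ?_ ?_ hle (Or.inr ⟨rfl, Or.inl hx⟩)
    · intro j a b
      simp only [D, dia_sup, Order.Ideal.sup_mem_iff]
      tauto
    · intro j
      simp [D, dia_bot]
    · rintro j a (⟨hj, ha⟩ | ⟨rfl, ha⟩)
      · exact Or.inl ⟨hj, by rwa [← dia_loeb]⟩
      · refine Or.inr ⟨rfl, ?_⟩
        -- If `U` satisfies `¬⟨n+1⟩a`, then `U` itself is the last witness; otherwise Löb's axiom in
        -- `M` supplies one beyond `U`.
        by_cases h : dia (n + 1) a ∈ J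
        · exact Or.inl (hinf (ha.resolve_right fun h' => h' h) (hnc h))
        · exact Or.inr (by rwa [← dia_loeb])
    · rintro i j a hij (⟨hj, ha⟩ | ⟨rfl, ha⟩)
      · exact Or.inl ⟨hij.trans hj, fun h => ha (J.lower (dia_anti i j a hij) h)⟩
      · rcases hij.lt_or_eq with h | rfl
        · have hin : i ≤ n := Nat.lt_succ_iff.1 h
          refine Or.inl ⟨hin, fun h' => ?_⟩
          rcases ha with ha | ha
          -- Here reflexivity of `U` is essential: the new point sees `U` via `⟨n+1⟩`, so it must
          -- also see it via each lower modality.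
          · exact hrefl ha (J.lower (dia_anti i n a hin) h')
          · exact ha (J.lower (dia_anti i (n + 1) a hij) h')
        · exact Or.inr ⟨rfl, ha⟩
    · rintro i j a hij hi (⟨hj, hb⟩ | ⟨rfl, hb⟩)
      · rcases hi with ⟨_, hi⟩ | ⟨h, _⟩
        · exact hb (hbox hij hi)
        · omega
      · rcases hi with ⟨_, hi⟩ | ⟨h, _⟩
        · exact hb.elim (fun h => h (hcompl hi)) fun h => h (hbox hij hi)
        · omega
  rcases key with ⟨-, h⟩ | ⟨h, -⟩
  · exact h hz
  · omega

theorem IsFreeOn.reductionProperty {α M : Type u} [GLPAlgebra M] {g : α → M}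
    (hg : IsFreeOn.{u, u, u} g) (n : ℕ) : ReductionProperty M n := by
  rintro x z ⟨F, hF, hFz⟩
  have hle : dia (n + 1) x ≤ dia n z :=
    (Finset.le_inf fun a ha => (Set.mem_singleton_iff.1 (hF ha)).ge).trans hFz
  obtain ⟨k, hk⟩ := hg.exists_algQ_le n x z hle
  exact ⟨{algQ n x k}, by simp, by simpa using hk⟩

end Reduction

/-! ### Relabelling of modalities and substitution -/

section Transport

open Formula

variable {α : Type u} {β : Type v} {γ : Type w}

/-- Relabelling of the modalities by `e` together with substitution of `σ a` for `a`. -/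
def Formula.transport (e : ℕ → ℕ) (σ : α → Formula β) : Formula α → Formula β
  | var a => σ a
  | bot => bot
  | imp φ ψ => imp (transport e σ φ) (transport e σ ψ)
  | box n φ => box (e n) (transport e σ φ)

theorem Formula.transport_dia (e : ℕ → ℕ) (σ : α → Formula β) (n : ℕ) (φ : Formula α) :
    transport e σ (dia n φ) = dia (e n) (transport e σ φ) := rfl

theorem Formula.transport_Q (e : ℕ → ℕ) (σ : α → Formula β) (n : ℕ) (φ : Formula α) (k : ℕ) :
    transport e σ (Q n φ k) = Q (e n) (transport e σ φ) k := by
  induction k with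
  | zero => rfl
  | succ k ih => rw [Q, Q, ← ih]; rfl

theorem Formula.transport_transport (e e' : ℕ → ℕ) (σ : α → Formula β) (τ : β → Formula γ)
    (φ : Formula α) :
    transport e' τ (transport e σ φ) = transport (e' ∘ e) (fun a => transport e' τ (σ a)) φ := by
  induction φ with
  | var a => rfl
  | bot => rfl
  | imp φ ψ h1 h2 => simp only [transport, h1, h2]
  | box n φ h => simp only [transport, h, Function.comp]

theorem Formula.transport_congr {e e' : ℕ → ℕ} {σ σ' : α → Formula β} {φ : Formula α}
    (he : ∀ n ∈ φ.mods, e n = e' n) (hσ : ∀ a ∈ φ.vars, σ a = σ' a) :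
    transport e σ φ = transport e' σ' φ := by
  induction φ with
  | var a => exact hσ a rfl
  | bot => rfl
  | imp φ ψ h1 h2 =>
    rw [transport, transport, h1 (fun n hn => he n (Or.inl hn)) fun a ha => hσ a (Or.inl ha),
      h2 (fun n hn => he n (Or.inr hn)) fun a ha => hσ a (Or.inr ha)]
  | box n φ h =>
    rw [transport, transport, he n (Set.mem_insert _ _),
      h (fun n hn => he n (Set.mem_insert_of_mem _ hn)) hσ]

theorem Formula.transport_id_var (φ : Formula α) : transport id var φ = φ := by
  induction φ with
  | var a => rfl
  | bot => rfl
  | imp φ ψ h1 h2 => rw [transport, h1, h2]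
  | box n φ h => rw [transport, h, id]

theorem Formula.depth_transport_var (e : ℕ → ℕ) (ρ : α → β) (φ : Formula α) :
    (transport e (fun a => var (ρ a)) φ).depth = φ.depth := by
  induction φ with
  | var a => rfl
  | bot => rfl
  | imp φ ψ h1 h2 => simp only [transport, depth, h1, h2]
  | box n φ h => simp only [transport, depth, h]

theorem Formula.vars_transport_var (e : ℕ → ℕ) (ρ : α → β) (φ : Formula α) :
    (transport e (fun a => var (ρ a)) φ).vars = ρ '' φ.vars := by
  induction φ with
  | var a => simp [transport, vars]
  | bot => simp [transport, vars]
  | imp φ ψ h1 h2 => simp only [transport, vars, h1, h2, Set.image_union]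
  | box n φ h => simp only [transport, vars, h]

theorem Formula.mods_transport_var (e : ℕ → ℕ) (ρ : α → β) (φ : Formula α) :
    (transport e (fun a => var (ρ a)) φ).mods = e '' φ.mods := by
  induction φ with
  | var a => simp [transport, mods]
  | bot => simp [transport, mods]
  | imp φ ψ h1 h2 => simp only [transport, mods, h1, h2, Set.image_union]
  | box n φ h => simp only [transport, mods, h, Set.image_insert_eq]

/-- The axioms mention labels only through their order, so a strictly increasing relabelling
preserves derivations. -/
theorem Provable.transport {e : ℕ → ℕ} (he : StrictMono e) (σ : α → Formula β) {φ : Formula α}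
    (h : Provable φ) : Provable (transport e σ φ) := by
  induction h with
  | taut φ h =>
    exact .taut _ fun t hb hi => h (fun χ => t (χ.transport e σ)) hb fun a b => hi _ _
  | distr n φ ψ => exact .distr _ _ _
  | loeb n φ => exact .loeb _ _
  | mono m n φ h => exact .mono _ _ _ (he.monotone h)
  | persist m n φ h => exact .persist _ _ _ (he h)
  | mp φ ψ _ _ h1 h2 => exact .mp _ _ h1 h2
  | nec n φ _ h => exact .nec _ _ h

theorem cls_transport_eq {e : ℕ → ℕ} (he : StrictMono e) (σ : α → Formula β) {φ ψ : Formula α}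
    (h : cls φ = cls ψ) : cls (φ.transport e σ) = cls (ψ.transport e σ) :=
  cls_eq (Provable.transport he σ (Lindenbaum.cls_le.1 h.le))
    (Provable.transport he σ (Lindenbaum.cls_le.1 h.ge))

theorem cls_Q (n : ℕ) (φ : Formula α) (k : ℕ) : cls (Q n φ k) = algQ n (cls φ) k := by
  induction k with
  | zero => rfl
  | succ k ih => rw [algQ, ← ih]; rfl

end Transport

/-! ### Finiteness of the set of formulas of bounded complexity up to equivalence -/

section Finiteness

open Formula

/-- Once the generators are closed under complement, De Morgan makes their lattice closure a Boolean
subalgebra, and in a distributive lattice that closure is finite. -/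
theorem finite_booleanClosure {B : Type u} [BooleanAlgebra B] {s : Set B} (hs : s.Finite) :
    (BooleanSubalgebra.closure s : Set B).Finite := by
  let t : Set B := (s ∪ {⊥}) ∪ compl '' (s ∪ {⊥})
  have ht : t.Finite := (hs.union (Set.finite_singleton _)).union
    ((hs.union (Set.finite_singleton _)).image _)
  have hct : compl '' t = t := by
    simp only [t, Set.image_union, ← Set.image_comp, compl_comp_compl, Set.image_id]
    exact Set.union_comm _ _
  let L : BooleanSubalgebra B :=
    { carrier := latticeClosure t
      supClosed' := isSublattice_latticeClosure.supClosed
      infClosed' := isSublattice_latticeClosure.infClosed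
      compl_mem' := fun {a} ha => by
        rw [← compl_image_latticeClosure_eq_of_compl_image_eq_self hct]
        exact Set.mem_image_of_mem _ ha
      bot_mem' := subset_latticeClosure (Or.inl (Or.inr rfl)) }
  have hL : (L : Set B).Finite := ht.latticeClosure
  refine hL.subset (BooleanSubalgebra.closure_le.2 ?_ : BooleanSubalgebra.closure s ≤ L)
  exact fun a ha => subset_latticeClosure (Or.inl (Or.inl ha))

/-- Formulas of depth at most `d + 1` are Boolean combinations of variables and boxed formulas of
depth at most `d`, and the class of `[n]φ` depends only on the class of `φ`. -/
theorem finite_cls (v N d : ℕ) :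
    {c : Lindenbaum ℕ | ∃ φ : Formula ℕ, φ.depth ≤ d ∧ φ.vars ⊆ Set.Iio v ∧
      φ.mods ⊆ Set.Iio N ∧ cls φ = c}.Finite := by
  have key : ∀ (d : ℕ) (s : Set (Lindenbaum ℕ)), (∀ a < v, gen a ∈ s) →
      (∀ (n : ℕ) (φ : Formula ℕ), n < N → φ.depth < d → φ.vars ⊆ Set.Iio v →
        φ.mods ⊆ Set.Iio N → cls (box n φ) ∈ s) →
      {c : Lindenbaum ℕ | ∃ φ : Formula ℕ, φ.depth ≤ d ∧ φ.vars ⊆ Set.Iio v ∧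
        φ.mods ⊆ Set.Iio N ∧ cls φ = c} ⊆ BooleanSubalgebra.closure s := by
    rintro d s hv hb _ ⟨φ, hd, hvφ, hmφ, rfl⟩
    induction φ with
    | var a => exact BooleanSubalgebra.subset_closure (hv a (hvφ rfl))
    | bot => exact BooleanSubalgebra.bot_mem
    | imp φ ψ h1 h2 =>
      rw [cls_imp]
      exact BooleanSubalgebra.sup_mem (BooleanSubalgebra.compl_mem
        (h1 ((le_max_left _ _).trans hd) (Set.subset_union_left.trans hvφ)
          (Set.subset_union_left.trans hmφ)))
        (h2 ((le_max_right _ _).trans hd) (Set.subset_union_right.trans hvφ)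
          (Set.subset_union_right.trans hmφ))
    | box n φ _ =>
      exact BooleanSubalgebra.subset_closure (hb n φ (hmφ (Set.mem_insert _ _)) hd hvφ
        ((Set.subset_insert _ _).trans hmφ))
  have hg : (gen '' Set.Iio v : Set (Lindenbaum ℕ)).Finite := (Set.finite_Iio v).image _
  induction d with
  | zero =>
    exact (finite_booleanClosure hg).subset
      (key 0 _ (fun a ha => Set.mem_image_of_mem _ ha) fun _ _ _ h => absurd h (Nat.not_lt_zero _))
  | succ d ih =>
    have hi := Set.Finite.image2 (fun (n : ℕ) (c : Lindenbaum ℕ) => (GLPAlgebra.dia n cᶜ)ᶜ)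
      (Set.finite_Iio N) ih
    refine (finite_booleanClosure (hg.union hi)).subset
      (key (d + 1) _ (fun a ha => Or.inl (Set.mem_image_of_mem _ ha)) fun n φ hn hd hv hm => ?_)
    exact Or.inr ⟨n, hn, cls φ, ⟨φ, Nat.lt_succ_iff.1 hd, hv, hm, rfl⟩, (cls_box n φ).symm⟩

end Finiteness

/-! ### Embeddings between finite sets of labels -/

/-- If the differences `g i - f i` are non-negative and non-decreasing for `i < N`, then the
labelling `g` factors through `f` on `{0, …, N - 1}`. -/
theorem exists_strictMono_comp_eq {N : ℕ} {f g : ℕ → ℕ} (hf : StrictMono f) (hg : StrictMono g)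
    (hle : ∀ i < N, f i ≤ g i) (hgap : ∀ i < N, f (i + 1) - f i ≤ g (i + 1) - g i) :
    ∃ e : ℕ → ℕ, StrictMono e ∧ ∀ i < N, e (f i) = g i := by
  have hmono : ∀ i j, i ≤ j → j < N → g i - f i ≤ g j - f j := by
    intro i j hij
    induction j, hij using Nat.le_induction with
    | base => exact fun _ => le_rfl
    | succ j hij ih =>
      intro hj
      have h1 := ih (by omega)
      have h2 := hgap j (by omega)
      have h3 := hle j (by omega)
      have h4 := hf (Nat.lt_add_one j)
      have h5 := hg (Nat.lt_add_one j)
      omega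
  let s : ℕ → Finset ℕ := fun n => (Finset.range N).filter fun i => f i ≤ n
  -- Each `n` is shifted by the largest shift required at a label `f i ≤ n`; below `f 0` the empty
  -- supremum gives shift `0`.
  refine ⟨fun n => n + (s n).sup fun i => g i - f i, fun a b hab => ?_, fun i hi => ?_⟩
  · refine add_lt_add_of_lt_of_le hab (Finset.sup_mono fun i hi => ?_)
    simp only [s, Finset.mem_filter] at hi ⊢
    exact ⟨hi.1, hi.2.trans hab.le⟩
  · have h : ((s (f i)).sup fun i => g i - f i) = g i - f i := by
      refine le_antisymm (Finset.sup_le fun j hj => ?_) (Finset.le_sup (f := fun i => g i - f i) ?_)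
      · simp only [s, Finset.mem_filter] at hj
        exact hmono j i (hf.le_iff_le.1 hj.2) hi
      · simp [s, hi]
    have := hle i hi
    simp only [h]
    omega

/-- Every finite set of labels is the image of an initial segment. -/
theorem exists_strictMono_leftInverse (S : Finset ℕ) : ∃ f c : ℕ → ℕ, StrictMono f ∧
    (∀ n ∈ S, f (c n) = n) ∧ (∀ n ∈ S, c n < S.card) ∧ ∀ n ∈ S, c (n + 1) = c n + 1 := by
  classical
  -- Adjoining everything above `S` makes the enumeration infinite, hence strictly increasing on all
  -- of `ℕ`.
  let p : ℕ → Prop := fun n => n ∈ S ∨ S.sup id < n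
  have hp : (Set.ofPred p).Infinite :=
    (Set.Ioi_infinite (S.sup id)).mono fun n hn => Or.inr hn
  refine ⟨Nat.nth p, Nat.count p, Nat.nth_strictMono hp, fun n hn => Nat.nth_count (Or.inl hn),
    fun n hn => ?_, fun n hn => ?_⟩
  · rw [Nat.count_eq_card_filter_range]
    refine Finset.card_lt_card ⟨fun i hi => ?_, fun h => ?_⟩
    · simp only [Finset.mem_filter, Finset.mem_range, p] at hi
      have : n ≤ S.sup id := Finset.le_sup (f := id) hn
      exact hi.2.resolve_right (by omega)
    · have := h hn
      simp at this
  · rw [Nat.count_succ, if_pos (Or.inl hn)]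

/-! ### The uniform bound -/

section Uniform

open Formula

/-- A labelled instance of the reduction problem: formulas of bounded complexity with variables
below `v` and modalities below `N`, the modalities being then transportled by `f`. -/
structure Shape (d v N : ℕ) where
  m : ℕ
  φ : Formula ℕ
  ψ : Formula ℕ
  f : ℕ → ℕ
  m_lt : m + 1 < N
  f_strictMono : StrictMono f
  f_succ : f (m + 1) = f m + 1
  φ_depth : φ.depth ≤ d
  φ_vars : φ.vars ⊆ Set.Iio v
  φ_mods : φ.mods ⊆ Set.Iio N
  ψ_depth : ψ.depth ≤ d
  ψ_vars : ψ.vars ⊆ Set.Iio v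
  ψ_mods : ψ.mods ⊆ Set.Iio N

namespace Shape

variable {d v N : ℕ}

/-- The reduction claim for a shape, with bound `k`. -/
def Reduces (t : Shape d v N) (k : ℕ) : Prop :=
  algQ (t.f t.m) (cls (t.ψ.transport t.f var)) k ≤
    GLPAlgebra.dia (t.f t.m) (cls (t.φ.transport t.f var))

theorem Reduces.mono {t : Shape d v N} {k l : ℕ} (h : t.Reduces k) (hkl : k ≤ l) :
    t.Reduces l :=
  (algQ_antitone _ _ hkl).trans h

theorem cls_transport_of_factor {s t : Shape d v N} {e : ℕ → ℕ}
    (hst : ∀ i < N, e (s.f i) = t.f i) {χ χ' : Formula ℕ} (hχ : χ.mods ⊆ Set.Iio N)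
    (hc : cls χ = cls χ') :
    cls ((χ.transport s.f var).transport e var) = cls (χ'.transport t.f var) := by
  rw [transport_transport]
  have : χ.transport (e ∘ s.f) (fun a => (var a).transport e var) = χ.transport t.f var :=
    transport_congr (fun n hn => hst n (hχ hn)) fun _ _ => rfl
  rw [this]
  exact cls_transport_eq t.f_strictMono var hc

/-- A derivation may use labels lying between those that occur; the gap condition leaves room to
relabel these too, so the derivation for `s` becomes one for `t`. -/
theorem Reduces.of_factor {s t : Shape d v N} {k : ℕ} (h : s.Reduces k) (hm : s.m = t.m)
    (hφ : cls s.φ = cls t.φ) (hψ : cls s.ψ = cls t.ψ)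
    (hle : ∀ i < N, s.f i ≤ t.f i)
    (hgap : ∀ i < N, s.f (i + 1) - s.f i ≤ t.f (i + 1) - t.f i) : t.Reduces k := by
  obtain ⟨e, he, hst⟩ := exists_strictMono_comp_eq s.f_strictMono t.f_strictMono hle hgap
  have hem : e (s.f s.m) = t.f t.m := by
    rw [hst _ (Nat.lt_of_succ_lt s.m_lt), hm]
  rw [Reduces, ← cls_Q, ← cls_dia, Lindenbaum.cls_le] at h
  have h1 := Provable.transport he var h
  rw [transport, transport_Q, transport_dia, hem, ← Lindenbaum.cls_le, cls_Q, cls_dia,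
    cls_transport_of_factor hst s.φ_mods hφ, cls_transport_of_factor hst s.ψ_mods hψ] at h1
  exact h1

theorem exists_uniform_bound (d v N : ℕ) : ∃ K : ℕ, ∀ t : Shape d v N,
    GLPAlgebra.dia (t.f t.m + 1) (cls (t.ψ.transport t.f var)) ≤
      GLPAlgebra.dia (t.f t.m) (cls (t.φ.transport t.f var)) → t.Reduces K := by
  by_contra! hne
  choose t ht hnot using hne
  let C := {c : Lindenbaum ℕ | ∃ φ : Formula ℕ, φ.depth ≤ d ∧ φ.vars ⊆ Set.Iio v ∧
      φ.mods ⊆ Set.Iio N ∧ cls φ = c}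
  have : Finite C := (finite_cls v N d).to_subtype
  let data : ℕ → (Fin N × C × C) × (Fin N → ℕ × ℕ) := fun K =>
    ((⟨(t K).m, Nat.lt_of_succ_lt (t K).m_lt⟩,
      ⟨cls (t K).φ, (t K).φ, (t K).φ_depth, (t K).φ_vars, (t K).φ_mods, rfl⟩,
      ⟨cls (t K).ψ, (t K).ψ, (t K).ψ_depth, (t K).ψ_vars, (t K).ψ_mods, rfl⟩),
      fun i => ((t K).f i, (t K).f (i + 1) - (t K).f i))
  -- Equality on a finite set is a well-quasi-order, and Dickson's lemma handles the tuples of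
  -- labels and gaps.
  have hw : WellQuasiOrdered fun a b : (Fin N × C × C) × (Fin N → ℕ × ℕ) =>
      a.1 = b.1 ∧ a.2 ≤ b.2 :=
    WellQuasiOrdered.prod (Finite.wellQuasiOrdered _)
      (WellQuasiOrdered.pi fun _ => wellQuasiOrdered_le)
  have : IsPreorder _ fun a b : (Fin N × C × C) × (Fin N → ℕ × ℕ) => a.1 = b.1 ∧ a.2 ≤ b.2 :=
    { refl := fun a => ⟨rfl, le_rfl⟩
      trans := fun a b c h k => ⟨h.1.trans k.1, h.2.trans k.2⟩ }
  obtain ⟨g, hg⟩ := hw.exists_monotone_subseq data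
  obtain ⟨k, hk⟩ := (isFreeOn_gen ℕ).exists_algQ_le _ _ _ (ht (g 0))
  -- The bound `k` of the first counterexample passes to the one at index `g k ≥ k`, which was
  -- chosen to violate the bound `g k`.
  obtain ⟨h1, h2⟩ := hg 0 k (Nat.zero_le k)
  have hr : (t (g k)).Reduces k :=
    Reduces.of_factor hk (congrArg (fun c => (c.1 : ℕ)) h1)
      (congrArg (fun c => (c.2.1 : Lindenbaum ℕ)) h1)
      (congrArg (fun c => (c.2.2 : Lindenbaum ℕ)) h1)
      (fun i hi => (h2 ⟨i, hi⟩).1) fun i hi => (h2 ⟨i, hi⟩).2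
  exact hnot (g k) (hr.mono g.strictMono.le_apply)

end Shape

/-- The variables and modalities of an instance of the reduction problem can be normalized. -/
theorem exists_shape {α : Type u} (m : ℕ) (φ ψ : Formula α) :
    ∃ (t : Shape (max φ.depth ψ.depth) (φ.vars ∪ ψ.vars).ncard ((φ.mods ∪ ψ.mods).ncard + 2))
      (ρ : α → ℕ) (σ : ℕ → Formula α), t.f t.m = m ∧
      φ.transport id (fun a => var (ρ a)) = t.φ.transport t.f var ∧
      ψ.transport id (fun a => var (ρ a)) = t.ψ.transport t.f var ∧
      (t.φ.transport t.f var).transport id σ = φ ∧ (t.ψ.transport t.f var).transport id σ = ψ := by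
  classical
  have hV : (φ.vars ∪ ψ.vars).Finite := φ.vars_finite.union ψ.vars_finite
  have hS : (φ.mods ∪ ψ.mods).Finite := φ.mods_finite.union ψ.mods_finite
  obtain ⟨ρ, hρ, hρi⟩ : ∃ ρ : α → ℕ, Set.MapsTo ρ (φ.vars ∪ ψ.vars)
      (Set.Iio (φ.vars ∪ ψ.vars).ncard) ∧ Set.InjOn ρ (φ.vars ∪ ψ.vars) := by
    obtain ⟨ρ, h1, h2⟩ := Set.Finite.exists_injOn_of_encard_le
      (s := φ.vars ∪ ψ.vars) (t := Set.Iio (φ.vars ∪ ψ.vars).ncard) hV (by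
        rw [← hV.cast_ncard_eq, ← (Set.finite_Iio _).cast_ncard_eq]
        simp [Set.ncard_eq_toFinset_card'])
    exact ⟨ρ, h1, h2⟩
  obtain ⟨σ, hσ⟩ : ∃ σ : ℕ → Formula α, ∀ a ∈ φ.vars ∪ ψ.vars, σ (ρ a) = var a := by
    refine ⟨fun i => if h : ∃ a ∈ φ.vars ∪ ψ.vars, ρ a = i then var h.choose else bot,
      fun a ha => ?_⟩
    have h : ∃ b ∈ φ.vars ∪ ψ.vars, ρ b = ρ a := ⟨a, ha, rfl⟩
    refine (dif_pos h).trans ?_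
    exact congrArg var (hρi h.choose_spec.1 ha h.choose_spec.2)
  -- The labels `m` and `m + 1` need not occur in `φ` or `ψ`; this accounts for the `+ 2`.
  let S : Finset ℕ := insert m (insert (m + 1) hS.toFinset)
  have hScard : S.card ≤ (φ.mods ∪ ψ.mods).ncard + 2 := by
    rw [Set.ncard_eq_toFinset_card _ hS]
    exact (Finset.card_insert_le _ _).trans (Nat.succ_le_succ (Finset.card_insert_le _ _))
  have hmS : m ∈ S := Finset.mem_insert_self _ _
  have hmS' : m + 1 ∈ S := Finset.mem_insert_of_mem (Finset.mem_insert_self _ _)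
  have hmods : ∀ n ∈ φ.mods ∪ ψ.mods, n ∈ S := fun n hn =>
    Finset.mem_insert_of_mem (Finset.mem_insert_of_mem (hS.mem_toFinset.2 hn))
  obtain ⟨f, c, hf, hfc, hcS, hcs⟩ := exists_strictMono_leftInverse S
  have hrel : ∀ χ : Formula α, χ.mods ⊆ φ.mods ∪ ψ.mods →
      (χ.transport c fun a => var (ρ a)).transport f var = χ.transport id fun a => var (ρ a) := by
    intro χ hχ
    rw [transport_transport]
    exact transport_congr (fun n hn => hfc n (hmods n (hχ hn))) fun _ _ => rfl
  have hback : ∀ χ : Formula α, χ.vars ⊆ φ.vars ∪ ψ.vars →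
      (χ.transport id fun a => var (ρ a)).transport id σ = χ := by
    intro χ hχ
    rw [transport_transport]
    exact (transport_congr (fun _ _ => rfl) fun a ha => hσ a (hχ ha)).trans χ.transport_id_var
  have hmod : ∀ χ : Formula α, χ.mods ⊆ φ.mods ∪ ψ.mods →
      (χ.transport c fun a => var (ρ a)).mods ⊆ Set.Iio ((φ.mods ∪ ψ.mods).ncard + 2) := by
    intro χ hχ
    rw [mods_transport_var]
    rintro _ ⟨n, hn, rfl⟩
    exact (hcS n (hmods n (hχ hn))).trans_le hScard
  have hvar : ∀ χ : Formula α, χ.vars ⊆ φ.vars ∪ ψ.vars →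
      (χ.transport c fun a => var (ρ a)).vars ⊆ Set.Iio (φ.vars ∪ ψ.vars).ncard := by
    intro χ hχ
    rw [vars_transport_var]
    rintro _ ⟨a, ha, rfl⟩
    exact hρ (hχ ha)
  refine ⟨⟨c m, φ.transport c fun a => var (ρ a), ψ.transport c fun a => var (ρ a), f, ?_, hf, ?_,
    (depth_transport_var _ _ _).trans_le (le_max_left _ _), hvar φ Set.subset_union_left,
    hmod φ Set.subset_union_left, (depth_transport_var _ _ _).trans_le (le_max_right _ _),
    hvar ψ Set.subset_union_right, hmod ψ Set.subset_union_right⟩, ρ, σ, hfc m hmS,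
    (hrel φ Set.subset_union_left).symm, (hrel ψ Set.subset_union_right).symm, ?_, ?_⟩
  · rw [← hcs m hmS]
    exact (hcS _ hmS').trans_le hScard
  · rw [← hcs m hmS, hfc _ hmS', hfc _ hmS]
  · rw [hrel φ Set.subset_union_left, hback φ Set.subset_union_left]
  · rw [hrel ψ Set.subset_union_right, hback ψ Set.subset_union_right]

theorem exists_uniform_reduction_bound : ∃ K : ℕ → ℕ → ℕ → ℕ,
    ∀ (α : Type u) (m : ℕ) (φ ψ : Formula α),
      Provable (.imp (.dia (m + 1) ψ) (.dia m φ)) →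
      Provable (.imp
        (.Q m ψ (K (max φ.depth ψ.depth) (φ.vars ∪ ψ.vars).ncard (φ.mods ∪ ψ.mods).ncard))
        (.dia m φ)) := by
  choose K hK using fun d v s => Shape.exists_uniform_bound d v (s + 2)
  refine ⟨K, fun α m φ ψ h => ?_⟩
  obtain ⟨t, ρ, σ, hm, hφ, hψ, hφ', hψ'⟩ := exists_shape m φ ψ
  -- Renaming the variables into `ℕ` makes the bound independent of `α`; the substitution `σ` undoes
  -- the renaming at the end.
  have h1 := Provable.transport strictMono_id (fun a => var (ρ a)) h
  rw [transport, transport_dia, transport_dia, hφ, hψ, id, id, ← hm, ← Lindenbaum.cls_le] at h1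
  have h2 := hK _ _ _ t h1
  rw [Shape.Reduces, ← cls_Q, ← cls_dia, Lindenbaum.cls_le] at h2
  have h3 := Provable.transport strictMono_id σ h2
  rwa [transport, transport_Q, transport_dia, hφ', hψ', hm, id] at h3

end Uniform

end GLP

theorem mainTheorem1 :
    -- The Lindenbaum algebra of GLP is the free GLP-algebra.
    (∀ α : Type u, GLP.IsFreeOn.{u, u, w} (GLP.gen (α := α))) ∧
    -- Its reduction properties, and those of every other free GLP-algebra.
    (∀ (α : Type u) (n : ℕ), GLP.ReductionProperty (GLP.Lindenbaum α) n) ∧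
    (∀ (α M : Type u) [GLP.GLPAlgebra M] (g : α → M), GLP.IsFreeOn.{u, u, u} g →
      ∀ n : ℕ, GLP.ReductionProperty M n) ∧
    -- The uniform version for formulas.
    (∃ K : ℕ → ℕ → ℕ → ℕ, ∀ (α : Type u) (m : ℕ) (φ ψ : GLP.Formula α),
      GLP.Provable (.imp (.dia (m + 1) ψ) (.dia m φ)) →
      GLP.Provable (.imp
        (.Q m ψ (K (max φ.depth ψ.depth) (φ.vars ∪ ψ.vars).ncard (φ.mods ∪ ψ.mods).ncard))
        (.dia m φ))) :=
  ⟨GLP.isFreeOn_gen, fun α n => (GLP.isFreeOn_gen α).reductionProperty n,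
    fun _ _ _ _ hg n => hg.reductionProperty n, GLP.exists_uniform_reduction_bound⟩
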